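/- For $a\in\mathbb{C}$ and $k\in\mathbb{N}_0$ let $(a)_k=a(a+1)\cdots(a+k-1)$, and let $${}_pF_q\left(\begin{array}{c}a_1,\dots,a_p\\ b_1,\dots,b_q\end{array};z\right)=\sum_{k=0}^\infty\frac{(a_1)_k\cdots(a_p)_k}{(b_1)_k\cdots(b_q)_k}\,\frac{z^k}{k!},$$ where, if some $(b_j)_k$ vanishes, the coefficient is understood after cancellation of common zeros, i.e. as the limit for $t\to0$ of the quotient with all parameters $a_i,b_j$ replaced by $a_i+t,b_j+t$. (Thus $(b+m)_k/(b)_k$ means $(b+k)_m/(b)_m$ whenever $(b)_m\neq0$; in particular $(f+1)_k/(f)_k=(f+k)/f$ for every $f\ne0$.) Let $r\geq 0$, let $m_1,\dots,m_r$ be positive integers, $n=m_1+\cdots+m_r$, and let $e_1,\dots,e_r,\alpha,\gamma,\epsilon\in\mathbb{C}$. Assume that $\gamma\notin\{0,-1,-2,\dots\}$ and that $e_i\notin\{0,-1,\dots,-(m_i-1)\}$ for all $i$ (so, for $m_i=1$, just $e_i\neq0$), and that the parameters are non-degenerate in the sense that $\alpha-e_i\notin\{0,1,\dots,m_i-1\}$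 for all $i$ and $\gamma-\alpha\notin\{1,2,\dots,n\}$. Then there exist $f_1,\dots,f_n\in\mathbb{C}\setminus\{0\}$ such that for all $x\in\mathbb{C}$ the two hypergeometric series below converge absolutely and $${}_{r+1}F_{r+1}\left(\begin{array}{c}\alpha,\ e_1+m_1,\dots,e_r+m_r\\ \gamma,\ e_1,\dots,e_r\end{array};\,-\epsilon x\right)=e^{-\epsilon x}\,{}_{n+1}F_{n+1}\left(\begin{array}{c}\gamma-\alpha-n,\ f_1+1,\dots,f_n+1\\ \gamma,\ f_1,\dots,f_n\end{array};\,\epsilon x\right).$$ -/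

import Mathlib

open Filter Topology

/-- The `k`-th coefficient `(a₁)ₖ ⋯ (a_p)ₖ / ((b₁)ₖ ⋯ (b_q)ₖ)` of the generalized hypergeometric
series. If no `(b_j)ₖ` vanishes this is the plain quotient (`genHypCoeff_eq`). If some `(b_j)ₖ`
vanishes, a vanishing denominator factor is cancelled against a vanishing numerator factor, by
shifting all parameters by `t` and letting `t → 0`; so for instance
`(b + 1)ₖ / (b)ₖ` is `(b + k) / b` for all `b ≠ 0` (`genHypCoeff_cons`). -/
noncomputable def genHypCoeff {p q : ℕ} (a : Fin p → ℂ) (b : Fin q → ℂ) (k : ℕ) : ℂ :=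
  limUnder (𝓝[≠] (0 : ℂ)) fun t : ℂ =>
    (∏ i, (ascPochhammer ℂ k).eval (a i + t)) / ∏ j, (ascPochhammer ℂ k).eval (b j + t)

/-- The `k`-th term of the generalized hypergeometric series `p F q (a; b; z)`. -/
noncomputable def genHypTerm {p q : ℕ} (a : Fin p → ℂ) (b : Fin q → ℂ) (z : ℂ) (k : ℕ) : ℂ :=
  genHypCoeff a b k * z ^ k / (k.factorial : ℂ)

/-- The generalized hypergeometric function `p F q (a; b; z)`. -/
noncomputable def genHyp {p q : ℕ} (a : Fin p → ℂ) (b : Fin q → ℂ) (z : ℂ) : ℂ :=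
  ∑' k : ℕ, genHypTerm a b z k

theorem genHypCoeff_eq {p q : ℕ} (a : Fin p → ℂ) (b : Fin q → ℂ) (k : ℕ)
    (hb : ∀ j, (ascPochhammer ℂ k).eval (b j) ≠ 0) :
    genHypCoeff a b k =
      (∏ i, (ascPochhammer ℂ k).eval (a i)) / ∏ j, (ascPochhammer ℂ k).eval (b j) := by
  have hc : ContinuousAt (fun t : ℂ =>
      (∏ i, (ascPochhammer ℂ k).eval (a i + t)) / ∏ j, (ascPochhammer ℂ k).eval (b j + t)) 0 := by
    refine ContinuousAt.div (by fun_prop) (by fun_prop) ?_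
    simpa [Finset.prod_ne_zero_iff] using hb
  have h := (hc.tendsto.mono_left (nhdsWithin_le_nhds (s := {0}ᶜ))).limUnder_eq
  simpa [genHypCoeff] using h

/-- For parameters of the form `α, e₁ + m₁, …, e_r + m_r; γ, e₁, …, e_r` with natural numbers `m_i`
the coefficient is `(α)ₖ / (γ)ₖ · ∏ (e_i + k)_{m_i} / (e_i)_{m_i}`. -/
theorem genHypCoeff_cons {r : ℕ} (α γ : ℂ) (e : Fin r → ℂ) (m : Fin r → ℕ) (k : ℕ)
    (hγ : (ascPochhammer ℂ k).eval γ ≠ 0)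
    (he : ∀ i, (ascPochhammer ℂ (m i)).eval (e i) ≠ 0) :
    genHypCoeff (Fin.cons α fun i => e i + m i : Fin (r + 1) → ℂ)
        (Fin.cons γ e : Fin (r + 1) → ℂ) k =
      (ascPochhammer ℂ k).eval α / (ascPochhammer ℂ k).eval γ *
        ∏ i, (ascPochhammer ℂ (m i)).eval (e i + k) / (ascPochhammer ℂ (m i)).eval (e i) := by
  have hc : ContinuousAt (fun t : ℂ =>
      (ascPochhammer ℂ k).eval (α + t) / (ascPochhammer ℂ k).eval (γ + t) *
        ((∏ i, (ascPochhammer ℂ (m i)).eval (e i + k + t)) /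
          ∏ i, (ascPochhammer ℂ (m i)).eval (e i + t))) 0 := by
    refine ContinuousAt.mul (ContinuousAt.div (by fun_prop) (by fun_prop) (by simpa using hγ))
      (ContinuousAt.div (by fun_prop) (by fun_prop) ?_)
    simpa [Finset.prod_ne_zero_iff] using he
  have hev : ∀ i (l : ℕ), ∀ᶠ t in 𝓝[≠] (0 : ℂ), (ascPochhammer ℂ l).eval (e i + t) ≠ 0 := by
    intro i l
    have hp : ((ascPochhammer ℂ l).comp (Polynomial.C (e i) + Polynomial.X)) ≠ 0 := by
      have : ((ascPochhammer ℂ l).comp (Polynomial.C (e i) + Polynomial.X)).Monic := by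
        rw [add_comm]
        exact (monic_ascPochhammer ℂ l).comp_X_add_C _
      exact this.ne_zero
    have hf := Polynomial.finite_setOfPred_isRoot hp
    have h3 : ({x | Polynomial.IsRoot ((ascPochhammer ℂ l).comp
        (Polynomial.C (e i) + Polynomial.X)) x} \ {0})ᶜ ∈ 𝓝 (0 : ℂ) :=
      (hf.subset Set.sdiff_subset).isClosed.isOpen_compl.mem_nhds (by simp)
    filter_upwards [nhdsWithin_le_nhds h3, self_mem_nhdsWithin] with t ht ht0 h0
    exact ht ⟨by simpa [Polynomial.IsRoot] using h0, ht0⟩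
  have hev' : ∀ᶠ t in 𝓝[≠] (0 : ℂ), ∀ i, (ascPochhammer ℂ k).eval (e i + t) ≠ 0 ∧
      (ascPochhammer ℂ (m i)).eval (e i + t) ≠ 0 :=
    eventually_all.2 fun i => (hev i k).and (hev i (m i))
  have h := (hc.tendsto.mono_left (nhdsWithin_le_nhds (s := {0}ᶜ)))
  have h' := (h.congr' (f₂ := fun t : ℂ =>
    (∏ i, (ascPochhammer ℂ k).eval ((Fin.cons α fun i => e i + m i : Fin (r + 1) → ℂ) i + t)) /
      ∏ j, (ascPochhammer ℂ k).eval ((Fin.cons γ e : Fin (r + 1) → ℂ) j + t)) (by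
    filter_upwards [hev'] with t ht
    simp only [Fin.prod_univ_succ, Fin.cons_zero, Fin.cons_succ]
    rw [mul_div_mul_comm, ← Finset.prod_div_distrib, ← Finset.prod_div_distrib]
    congr 1
    refine Finset.prod_congr rfl fun i _ => ?_
    rw [div_eq_div_iff (ht i).2 (ht i).1]
    have e1 := congrArg (Polynomial.eval (e i + t)) (ascPochhammer_mul ℂ k (m i))
    have e2 := congrArg (Polynomial.eval (e i + t)) (ascPochhammer_mul ℂ (m i) k)
    rw [add_comm (m i) k, ← e1] at e2
    simp only [Polynomial.eval_mul, Polynomial.eval_comp, Polynomial.eval_add, Polynomial.eval_X,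
      Polynomial.eval_natCast] at e2
    rw [add_right_comm (e i) (k : ℂ) t, add_right_comm (e i) (m i : ℂ) t]
    linear_combination -e2)).limUnder_eq
  rw [genHypCoeff, h']
  simp [Finset.prod_div_distrib]

/-! The left coefficients are `(α)_k / (γ)_k * P(k)`, where `P` has degree at most `n` and `P(0) =
1`. Multiplying the series by `exp (εx)` replaces them by a binomial transform
(`exp_mul_tsum_eq_tsum_binomial_transform`). Write `P(x) = ∑ c_j (α + x)_j`; since `(α)_k (α + k)_j
= (α)_j (α + j)_k`, Chu–Vandermonde turns the `j`-th summand into a multiple of `(γ - α - j)_N /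
(γ)_N`. From each of these `(γ - α - n)_N / (γ)_N` splits off, leaving a polynomial in `N` of degree
`n - j`. Their sum `Q` has `Q(0) = P(0) = 1` and degree exactly `n`, because `c_0 = P(-α) ≠ 0`
(`exists_polynomial_binomial_transform`). The `f_j` are the negated roots of `Q`. -/

theorem ascPochhammer_succ_left_eval (k : ℕ) (a : ℂ) :
    (ascPochhammer ℂ (k + 1)).eval a = a * (ascPochhammer ℂ k).eval (a + 1) := by
  simp [ascPochhammer_succ_left, Polynomial.eval_comp]

theorem ascPochhammer_eval_add (k l : ℕ) (a : ℂ) :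
    (ascPochhammer ℂ (k + l)).eval a =
      (ascPochhammer ℂ k).eval a * (ascPochhammer ℂ l).eval (a + k) := by
  simp [← ascPochhammer_mul, Polynomial.eval_comp]

theorem ascPochhammer_eval_ne_zero {k : ℕ} {a : ℂ} (h : ∀ s : ℕ, s < k → a + s ≠ 0) :
    (ascPochhammer ℂ k).eval a ≠ 0 := by
  induction k with
  | zero => simp
  | succ k ih =>
    rw [ascPochhammer_succ_eval]
    exact mul_ne_zero (ih fun s hs => h s (by omega)) (h k (by omega))

/-- A polynomial of degree at most `n` is a combination of the shifted rising factorials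
`(a + x)_j`, `j ≤ n`. -/
theorem exists_eval_eq_sum_ascPochhammer (n : ℕ) (P : Polynomial ℂ) (hP : P.natDegree ≤ n)
    (a : ℂ) : ∃ c : ℕ → ℂ, ∀ x, P.eval x =
      ∑ j ∈ Finset.range (n + 1), c j * (ascPochhammer ℂ j).eval (a + x) := by
  induction n generalizing P a with
  | zero =>
    rw [Polynomial.eq_C_of_natDegree_le_zero hP]
    exact ⟨fun _ => P.coeff 0, fun x => by simp⟩
  | succ n ih =>
    -- The base moves to `a + 1` because `(a + x)_{j+1} = (a + x) (a + 1 + x)_j`; the remainder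
    -- `P(-a)` becomes the coefficient at `j = 0`.
    obtain ⟨c, hc⟩ := ih (P /ₘ (Polynomial.X - Polynomial.C (-a)))
      (by rw [Polynomial.natDegree_divByMonic _ (Polynomial.monic_X_sub_C _),
            Polynomial.natDegree_X_sub_C]; omega) (a + 1)
    refine ⟨fun j => Nat.casesOn j (P.eval (-a)) c, fun x => ?_⟩
    have h := congrArg (Polynomial.eval x)
      (Polynomial.modByMonic_add_div P (Polynomial.X - Polynomial.C (-a)))
    rw [Polynomial.modByMonic_X_sub_C_eq_C_eval] at h
    rw [← h, Finset.sum_range_succ']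
    simp only [Polynomial.eval_add, Polynomial.eval_mul, hc, ascPochhammer_succ_left_eval,
      Polynomial.eval_C, Polynomial.eval_sub, Polynomial.eval_X, ascPochhammer_zero,
      Polynomial.eval_one, Finset.mul_sum]
    rw [mul_one, add_comm]
    congr 1
    refine Finset.sum_congr rfl fun j _ => ?_
    rw [add_right_comm a 1 x]
    ring

/-- The Chu–Vandermonde summation. -/
theorem sum_choose_ascPochhammer_div (N : ℕ) (a c : ℂ) (hc : ∀ s : ℕ, c + s ≠ 0) :
    ∑ p ∈ Finset.HasAntidiagonal.antidiagonal N, (N.choose p.1 : ℂ) *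
        ((-1) ^ p.1 * ((ascPochhammer ℂ p.1).eval a / (ascPochhammer ℂ p.1).eval c)) =
      (ascPochhammer ℂ N).eval (c - a) / (ascPochhammer ℂ N).eval c := by
  induction N generalizing a c with
  | zero => simp
  | succ N ih =>
    have hc' : ∀ s : ℕ, c + 1 + s ≠ 0 := fun s => by
      have := hc (s + 1); push_cast at this; rwa [add_assoc, add_comm (1 : ℂ)]
    have hc0 : c ≠ 0 := by simpa using hc 0
    have h1 := ih a c hc
    have h2 := ih (a + 1) (c + 1) hc'
    -- Pascal's rule; the second sum is the case `(a + 1, c + 1)`, with the same difference `c - a`.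
    rw [Finset.sum_antidiagonal_choose_succ_mul (fun i _ => (-1 : ℂ) ^ i *
      ((ascPochhammer ℂ i).eval a / (ascPochhammer ℂ i).eval c)), h1]
    have h3 : ∑ p ∈ Finset.HasAntidiagonal.antidiagonal N, (N.choose p.2 : ℂ) *
        ((-1 : ℂ) ^ (p.1 + 1) * ((ascPochhammer ℂ (p.1 + 1)).eval a / (ascPochhammer ℂ (p.1 + 1)).eval c)) =
        -(a / c) * ((ascPochhammer ℂ N).eval (c - a) / (ascPochhammer ℂ N).eval (c + 1)) := by
      rw [add_sub_add_right_eq_sub] at h2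
      rw [← h2, Finset.mul_sum]
      refine Finset.sum_congr rfl fun p hp => ?_
      rw [Nat.choose_symm_of_eq_add (Finset.HasAntidiagonal.mem_antidiagonal.1 hp).symm,
        ascPochhammer_succ_left_eval, ascPochhammer_succ_left_eval, mul_div_mul_comm]
      ring
    have n1 := ascPochhammer_eval_ne_zero (k := N) fun s _ => hc s
    have n2 := ascPochhammer_eval_ne_zero (k := N) fun s _ => hc' s
    have n3 := hc N
    have h4 : c * (ascPochhammer ℂ N).eval (c + 1) = (ascPochhammer ℂ N).eval c * (c + N) := by
      rw [← ascPochhammer_succ_left_eval, ascPochhammer_succ_eval]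
    rw [h3, ascPochhammer_succ_eval, ascPochhammer_succ_eval]
    have h5 : (ascPochhammer ℂ N).eval (c + 1) = (ascPochhammer ℂ N).eval c * (c + N) / c := by
      rw [← h4]; field_simp
    rw [h5]
    field_simp
    ring

/-! ### Growth and convergence -/

/-- Quotients of rising factorials grow at most geometrically. -/
theorem exists_norm_ascPochhammer_div_le (a c : ℂ) (hc : ∀ s : ℕ, c + s ≠ 0) :
    ∃ C : ℝ, ∀ k : ℕ,
      ‖(ascPochhammer ℂ k).eval a / (ascPochhammer ℂ k).eval c‖ ≤ C ^ k := by
  -- These are the ratios `(a + s) / (c + s)` of consecutive quotients; being convergent, they are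
  -- bounded.
  have ht : Tendsto (fun s : ℕ => 1 + (a - c) / (c + s)) atTop (𝓝 (1 + 0)) := by
    have h : Tendsto (fun s : ℕ => (c + s)⁻¹) atTop (𝓝 0) :=
      tendsto_inv₀_cobounded.comp
        ((tendsto_const_add_cobounded c).comp tendsto_natCast_atTop_cobounded)
    simpa [div_eq_mul_inv] using (h.const_mul (a - c)).const_add 1
  obtain ⟨C, hC⟩ := ht.norm.bddAbove_range
  refine ⟨C, fun k => ?_⟩
  induction k with
  | zero => simp
  | succ k ih =>
    have h : ‖(a + k) / (c + k)‖ ≤ C := by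
      have := hC ⟨k, rfl⟩
      have h' : 1 + (a - c) / (c + k) = (a + k) / (c + k) := by
        have := hc k
        field_simp
        ring
      rwa [← h']
    rw [ascPochhammer_succ_eval, ascPochhammer_succ_eval, mul_div_mul_comm, norm_mul, pow_succ]
    exact mul_le_mul ih h (norm_nonneg _) ((norm_nonneg _).trans ih)

theorem summable_ascPochhammer_div (a c z : ℂ) (hc : ∀ s : ℕ, c + s ≠ 0) :
    Summable fun k : ℕ => (ascPochhammer ℂ k).eval a / (ascPochhammer ℂ k).eval c *
      z ^ k / (k.factorial : ℂ) := by
  obtain ⟨C, hC⟩ := exists_norm_ascPochhammer_div_le a c hc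
  refine Summable.of_norm_bounded (Real.summable_pow_div_factorial (C * ‖z‖)) fun k => ?_
  rw [norm_div, norm_mul, norm_pow, Complex.norm_natCast, mul_pow]
  gcongr
  exact hC k

/-! ### Factorization and the binomial transform -/

/-- A complex polynomial of degree `n` with value `1` at `0` is a product of `n` factors
`(f + x) / f`. -/
theorem exists_eval_eq_prod_add_div (Q : Polynomial ℂ) (hQ : Q.eval 0 = 1) :
    ∃ f : Fin Q.natDegree → ℂ, (∀ j, f j ≠ 0) ∧ ∀ x, Q.eval x = ∏ j, (f j + x) / f j := by
  have hs := IsAlgClosed.splits Q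
  have hcard := hs.natDegree_eq_card_roots
  have hprod := hs.eq_prod_roots
  have h0 : ∀ z ∈ Q.roots, z ≠ 0 := by
    rintro z hz rfl
    have := Polynomial.isRoot_of_mem_roots hz
    rw [Polynomial.IsRoot, hQ] at this
    exact one_ne_zero this
  obtain ⟨l, hl⟩ : ∃ l : List ℂ, (l : Multiset ℂ) = Q.roots := Quot.exists_rep _
  rw [← hl] at hcard hprod h0
  have hlen : Q.natDegree = l.length := by simpa using hcard
  rw [hlen]
  have hev : ∀ x, Q.eval x = Q.leadingCoeff * ∏ j : Fin l.length, (-l[j] + x) := fun x => by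
    conv_lhs => rw [hprod]
    rw [Polynomial.eval_mul, Polynomial.eval_C, Polynomial.eval_multiset_prod]
    simp only [Multiset.map_coe, Multiset.prod_coe, List.map_map]
    rw [← Fin.prod_univ_fun_getElem]
    congr 1
    refine Finset.prod_congr rfl fun j _ => ?_
    simp
    ring
  have hne : ∀ j : Fin l.length, -l[j] ≠ 0 := fun j =>
    neg_ne_zero.2 (h0 _ (by simp))
  refine ⟨fun j => -l[j], hne, fun x => ?_⟩
  -- The value at `0` determines the leading coefficient.
  have h1 := hev 0
  rw [hQ] at h1
  simp only [add_zero] at h1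
  rw [Finset.prod_div_distrib, eq_div_iff (Finset.prod_ne_zero_iff.2 fun j _ => hne j), hev x]
  linear_combination (-∏ j : Fin l.length, (-l[j] + x)) * h1

/-- Multiplication by a polynomial of degree `n` acts on binomial transforms of hypergeometric
coefficients through another polynomial of degree `n`. -/
theorem exists_polynomial_binomial_transform (n : ℕ) (P : Polynomial ℂ) (hP : P.natDegree ≤ n)
    (α γ : ℂ) (hγ : ∀ s : ℕ, γ + s ≠ 0) (hP0 : P.eval 0 = 1) (hPα : P.eval (-α) ≠ 0)
    (hαγ : ∀ s : ℕ, s < n → γ - α - n + s ≠ 0) :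
    ∃ Q : Polynomial ℂ, Q.natDegree = n ∧ Q.eval 0 = 1 ∧ ∀ N : ℕ,
      ∑ p ∈ Finset.HasAntidiagonal.antidiagonal N, (N.choose p.1 : ℂ) * ((-1) ^ p.1 *
        ((ascPochhammer ℂ p.1).eval α / (ascPochhammer ℂ p.1).eval γ * P.eval (p.1 : ℂ))) =
      (ascPochhammer ℂ N).eval (γ - α - n) / (ascPochhammer ℂ N).eval γ * Q.eval (N : ℂ) := by
  obtain ⟨c, hc⟩ := exists_eval_eq_sum_ascPochhammer n P hP α
  have hb : ∀ j ≤ n, (ascPochhammer ℂ j).eval (γ - α - n) ≠ 0 := fun j hj =>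
    ascPochhammer_eval_ne_zero fun s hs => hαγ s (by omega)
  have hc0 : c 0 ≠ 0 := by
    -- At `x = -α` every `(0)_j` with `j ≥ 1` vanishes, so `c 0 = P(-α)`.
    have := hc (-α)
    rw [Finset.sum_range_succ', Finset.sum_eq_zero (fun j _ => by
      simp [ascPochhammer_ne_zero_eval_zero])] at this
    simp at this
    rwa [← this]
  have hmon : ∀ j, ((ascPochhammer ℂ j).comp (Polynomial.X + Polynomial.C (γ - α - n))).Monic :=
    fun j => (monic_ascPochhammer ℂ j).comp_X_add_C _
  have hdeg : ∀ j, ((ascPochhammer ℂ j).comp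
      (Polynomial.X + Polynomial.C (γ - α - n))).natDegree = j := fun j => by
    rw [Polynomial.natDegree_comp, ascPochhammer_natDegree, Polynomial.natDegree_X_add_C, mul_one]
  -- With `b = γ - α - n`, the choice comes from `(b)_N (b + N)_{n-j} = (b)_{n-j} (γ - α - j)_N`.
  let T : ℕ → Polynomial ℂ := fun j =>
    Polynomial.C (c j * (ascPochhammer ℂ j).eval α / (ascPochhammer ℂ (n - j)).eval (γ - α - n)) *
      (ascPochhammer ℂ (n - j)).comp (Polynomial.X + Polynomial.C (γ - α - n))
  have hTdeg : ∀ j, (T j).natDegree ≤ n - j := fun j =>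
    (Polynomial.natDegree_C_mul_le _ _).trans (hdeg _).le
  have hTeval : ∀ j x, (T j).eval x = c j * (ascPochhammer ℂ j).eval α /
      (ascPochhammer ℂ (n - j)).eval (γ - α - n) *
        (ascPochhammer ℂ (n - j)).eval (γ - α - n + x) := fun j x => by
    simp [T, Polynomial.eval_comp, add_comm x]
  refine ⟨∑ j ∈ Finset.range (n + 1), T j, ?_, ?_, fun N => ?_⟩
  · refine le_antisymm (Polynomial.natDegree_sum_le_of_forall_le _ _
      fun j _ => (hTdeg j).trans (Nat.sub_le _ _)) (Polynomial.le_natDegree_of_ne_zero ?_)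
    -- Only `T 0` reaches degree `n`; its leading coefficient is `c 0 / (γ - α - n)_n`.
    rw [Polynomial.finsetSum_coeff, Finset.sum_range_succ', Finset.sum_eq_zero fun j hj => ?_]
    · have h1 := (hmon n).coeff_natDegree
      rw [hdeg] at h1
      simp only [T, zero_add, Nat.sub_zero, Polynomial.coeff_C_mul, h1]
      simp [hc0, hb n le_rfl]
    · exact Polynomial.coeff_eq_zero_of_natDegree_lt
        ((hTdeg _).trans_lt (by have := Finset.mem_range.1 hj; omega))
  · rw [Polynomial.eval_finsetSum, ← hP0, hc]
    refine Finset.sum_congr rfl fun j _ => ?_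
    rw [hTeval, add_zero, add_zero, div_mul_cancel₀ _ (hb _ (Nat.sub_le _ _))]
  · rw [Polynomial.eval_finsetSum, Finset.mul_sum]
    simp only [hc, Finset.mul_sum]
    rw [Finset.sum_comm]
    refine Finset.sum_congr rfl fun j hj => ?_
    have hjn : j ≤ n := by have := Finset.mem_range.1 hj; omega
    have hcv := sum_choose_ascPochhammer_div N (α + j) γ hγ
    have h1 : (ascPochhammer ℂ N).eval (γ - α - n) *
        (ascPochhammer ℂ (n - j)).eval (γ - α - n + N) =
        (ascPochhammer ℂ (n - j)).eval (γ - α - n) *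
          (ascPochhammer ℂ N).eval (γ - (α + j)) := by
      rw [← ascPochhammer_eval_add, add_comm N, ascPochhammer_eval_add]
      congr 2
      push_cast [hjn]
      ring
    have h2 : c j * (ascPochhammer ℂ j).eval α *
        ((ascPochhammer ℂ N).eval (γ - (α + j)) / (ascPochhammer ℂ N).eval γ) =
        (ascPochhammer ℂ N).eval (γ - α - n) / (ascPochhammer ℂ N).eval γ *
          (T j).eval (N : ℂ) := by
      have hbj := hb (n - j) (Nat.sub_le _ _)
      have hγN := ascPochhammer_eval_ne_zero (k := N) fun s _ => hγ s
      rw [hTeval]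
      field_simp
      linear_combination (-c j * (ascPochhammer ℂ j).eval α) * h1
    rw [← h2, ← hcv, Finset.mul_sum]
    refine Finset.sum_congr rfl fun p _ => ?_
    have h3 : (ascPochhammer ℂ p.1).eval α * (ascPochhammer ℂ j).eval (α + p.1) =
        (ascPochhammer ℂ j).eval α * (ascPochhammer ℂ p.1).eval (α + j) := by
      rw [← ascPochhammer_eval_add, add_comm, ascPochhammer_eval_add]
    linear_combination (N.choose p.1 : ℂ) * (-1) ^ p.1 * c j /
      (ascPochhammer ℂ p.1).eval γ * h3

/-- Expanding `P` in the `(a + x)_j` absorbs it into shifts `a + j` of the upper parameter. -/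
theorem summable_ascPochhammer_div_mul_eval (a c z : ℂ) (P : Polynomial ℂ)
    (hc : ∀ s : ℕ, c + s ≠ 0) :
    Summable fun k : ℕ => (ascPochhammer ℂ k).eval a / (ascPochhammer ℂ k).eval c *
      P.eval (k : ℂ) * z ^ k / (k.factorial : ℂ) := by
  obtain ⟨d, hd⟩ := exists_eval_eq_sum_ascPochhammer P.natDegree P le_rfl a
  have h : Summable fun k : ℕ => ∑ j ∈ Finset.range (P.natDegree + 1),
      d j * (ascPochhammer ℂ j).eval a *
        ((ascPochhammer ℂ k).eval (a + j) / (ascPochhammer ℂ k).eval c *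
          z ^ k / (k.factorial : ℂ)) :=
    summable_sum fun j _ => (summable_ascPochhammer_div (a + j) c z hc).mul_left _
  refine h.congr fun k => ?_
  rw [hd, Finset.mul_sum, Finset.sum_mul, Finset.sum_div]
  refine Finset.sum_congr rfl fun j _ => ?_
  have h3 : (ascPochhammer ℂ k).eval a * (ascPochhammer ℂ j).eval (a + k) =
      (ascPochhammer ℂ j).eval a * (ascPochhammer ℂ k).eval (a + j) := by
    rw [← ascPochhammer_eval_add, add_comm, ascPochhammer_eval_add]
  linear_combination (-d j / (ascPochhammer ℂ k).eval c * z ^ k / (k.factorial : ℂ)) * h3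

/-- A power series in `-z`, multiplied by `exp z`, has the binomial transform as coefficients. -/
theorem exp_mul_tsum_eq_tsum_binomial_transform (u v : ℕ → ℂ) (z : ℂ)
    (hu : Summable fun k : ℕ => u k * (-z) ^ k / (k.factorial : ℂ))
    (huv : ∀ N : ℕ, ∑ p ∈ Finset.HasAntidiagonal.antidiagonal N,
      (N.choose p.1 : ℂ) * ((-1) ^ p.1 * u p.1) = v N) :
    Complex.exp z * ∑' k : ℕ, u k * (-z) ^ k / (k.factorial : ℂ) =
      ∑' N : ℕ, v N * z ^ N / (N.factorial : ℂ) := by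
  have hexp := NormedSpace.expSeries_div_hasSum_exp z
  rw [Complex.exp_eq_exp_ℂ, ← hexp.tsum_eq, mul_comm,
    tsum_mul_tsum_eq_tsum_sum_antidiagonal_of_summable_norm hu.norm hexp.summable.norm]
  refine tsum_congr fun N => ?_
  rw [← huv, Finset.sum_mul, Finset.sum_div]
  refine Finset.sum_congr rfl fun p hp => ?_
  obtain ⟨i, k⟩ := p
  obtain rfl : i + k = N := Finset.HasAntidiagonal.mem_antidiagonal.1 hp
  have h1 : ((i + k).choose i : ℂ) * i.factorial * k.factorial = (i + k).factorial := by
    rw [Nat.choose_symm_add]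
    exact_mod_cast Nat.add_choose_mul_factorial_mul_factorial i k
  have hi : (i.factorial : ℂ) ≠ 0 := by exact_mod_cast i.factorial_ne_zero
  have hk : (k.factorial : ℂ) ≠ 0 := by exact_mod_cast k.factorial_ne_zero
  have hik : ((i + k).factorial : ℂ) ≠ 0 := by exact_mod_cast (i + k).factorial_ne_zero
  rw [neg_pow, pow_add]
  field_simp
  linear_combination (-u i * z ^ i * z ^ k) * h1

/-! ### The transformation formula -/

theorem mainTheorem5 (r n : ℕ) (e : Fin r → ℂ) (m : Fin r → ℕ) (α γ ε : ℂ)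
    (hm : ∀ i, 0 < m i) (hn : n = ∑ i, m i)
    -- both sides are defined
    (hγ : ∀ s : ℕ, γ ≠ -(s : ℂ))
    (he : ∀ i, ∀ s : ℕ, s < m i → e i ≠ -(s : ℂ))
    -- the parameters are not degenerate
    (hαe : ∀ i, ∀ s : ℕ, s < m i → α ≠ e i + s)
    (hαγ : ∀ s : ℕ, 1 ≤ s → s ≤ n → γ ≠ α + s) :
    ∃ f : Fin n → ℂ, (∀ j, f j ≠ 0) ∧ ∀ x : ℂ,
      Summable (genHypTerm (Fin.cons α fun i => e i + m i : Fin (r + 1) → ℂ)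
        (Fin.cons γ e : Fin (r + 1) → ℂ) (-(ε * x))) ∧
      Summable (genHypTerm (Fin.cons (γ - α - n) fun j => f j + 1 : Fin (n + 1) → ℂ)
        (Fin.cons γ f : Fin (n + 1) → ℂ) (ε * x)) ∧
      genHyp (Fin.cons α fun i => e i + m i : Fin (r + 1) → ℂ)
          (Fin.cons γ e : Fin (r + 1) → ℂ) (-(ε * x)) =
        Complex.exp (-(ε * x)) *
          genHyp (Fin.cons (γ - α - n) fun j => f j + 1 : Fin (n + 1) → ℂ)
            (Fin.cons γ f : Fin (n + 1) → ℂ) (ε * x) := by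
  have hγ' : ∀ s : ℕ, γ + s ≠ 0 := fun s h => hγ s (eq_neg_of_add_eq_zero_left h)
  have hγk : ∀ k, (ascPochhammer ℂ k).eval γ ≠ 0 := fun k =>
    ascPochhammer_eval_ne_zero fun s _ => hγ' s
  have hem : ∀ i, (ascPochhammer ℂ (m i)).eval (e i) ≠ 0 := fun i =>
    ascPochhammer_eval_ne_zero fun s hs h => he i s hs (eq_neg_of_add_eq_zero_left h)
  let P : Polynomial ℂ := ∏ i, Polynomial.C ((ascPochhammer ℂ (m i)).eval (e i))⁻¹ *
    (ascPochhammer ℂ (m i)).comp (Polynomial.X + Polynomial.C (e i))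
  have hPeval : ∀ x, P.eval x = ∏ i, (ascPochhammer ℂ (m i)).eval (e i + x) /
      (ascPochhammer ℂ (m i)).eval (e i) := fun x => by
    simp only [P, Polynomial.eval_prod, Polynomial.eval_mul, Polynomial.eval_C,
      Polynomial.eval_comp, Polynomial.eval_add, Polynomial.eval_X]
    exact Finset.prod_congr rfl fun i _ => by rw [add_comm x]; ring
  have hPdeg : P.natDegree ≤ n := by
    rw [hn]
    refine (Polynomial.natDegree_prod_le _ _).trans (Finset.sum_le_sum fun i _ => ?_)
    refine (Polynomial.natDegree_C_mul_le _ _).trans ?_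
    rw [Polynomial.natDegree_comp, ascPochhammer_natDegree, Polynomial.natDegree_X_add_C, mul_one]
  obtain ⟨Q, hQdeg, hQ0, hPQ⟩ := exists_polynomial_binomial_transform n P hPdeg α γ hγ'
    (by rw [hPeval]; exact Finset.prod_eq_one fun i _ => by rw [add_zero, div_self (hem i)])
    (by
      rw [hPeval]
      refine Finset.prod_ne_zero_iff.2 fun i _ => div_ne_zero
        (ascPochhammer_eval_ne_zero fun s hs h => hαe i s hs ?_) (hem i)
      linear_combination -h)
    (fun s hs h => hαγ (n - s) (by omega) (by omega) (by
      push_cast [hs.le]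
      linear_combination h))
  obtain ⟨f, hf, hQf⟩ : ∃ f : Fin n → ℂ, (∀ j, f j ≠ 0) ∧
      ∀ x, Q.eval x = ∏ j, (f j + x) / f j := hQdeg ▸ exists_eval_eq_prod_add_div Q hQ0
  have hL : ∀ z k, genHypTerm (Fin.cons α fun i => e i + m i : Fin (r + 1) → ℂ)
      (Fin.cons γ e : Fin (r + 1) → ℂ) z k =
      (ascPochhammer ℂ k).eval α / (ascPochhammer ℂ k).eval γ * P.eval (k : ℂ) * z ^ k /
        (k.factorial : ℂ) := fun z k => by
    rw [genHypTerm, genHypCoeff_cons α γ e m k (hγk k) hem, hPeval]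
  have hR : ∀ z k, genHypTerm (Fin.cons (γ - α - n) fun j => f j + 1 : Fin (n + 1) → ℂ)
      (Fin.cons γ f : Fin (n + 1) → ℂ) z k =
      (ascPochhammer ℂ k).eval (γ - α - n) / (ascPochhammer ℂ k).eval γ * Q.eval (k : ℂ) * z ^ k /
        (k.factorial : ℂ) := fun z k => by
    -- With all shifts equal to `1`, the extra factors are `(f_j + k) / f_j`, whose product is
    -- `Q(k)`.
    have h := genHypCoeff_cons (γ - α - n) γ f (fun _ => 1) k (hγk k) (by simpa using hf)
    simp only [Nat.cast_one, ascPochhammer_one, Polynomial.eval_X] at h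
    rw [genHypTerm, h, hQf]
  refine ⟨f, hf, fun x => ?_⟩
  have hsum := summable_ascPochhammer_div_mul_eval α γ (-(ε * x)) P hγ'
  refine ⟨hsum.congr fun k => (hL _ k).symm,
    (summable_ascPochhammer_div_mul_eval (γ - α - n) γ (ε * x) Q hγ').congr
      fun k => (hR _ k).symm, ?_⟩
  rw [genHyp, genHyp, tsum_congr (hL _), tsum_congr (hR _),
    ← exp_mul_tsum_eq_tsum_binomial_transform _ _ (ε * x) hsum hPQ, ← mul_assoc, ← Complex.exp_add,
    neg_add_cancel, Complex.exp_zero, one_mul]
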